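/- Let $d\ge 0$ and $n\ge 2$ be integers and $p\in(0,1)$ with $p>n^{-d}$. Fractal percolation is the following random compact set. Divide the unit cube $[0,1]^d\subset\mathbb{R}^d$ into $n^d$ compact cubes of side length $1/n$ and keep each of them independently with probability $p$; let $Q_1$ be the union of the kept cubes. Repeat the process independently in each surviving cube to obtain a union $Q_2$ of cubes of side length $n^{-2}$, and so on, and put $F=\bigcap_{k\in\mathbb{N}}Q_k$. For a non-empty subset $E$ of a metric space and $r>0$, let $N_r(E)$ be the smallest number of sets of diameter at most $r$ required to cover $E$, and let the Assouad dimension of $E$ be $$\dim_{\mathrm A}E=\inf\Big\{\alpha\ge 0:\ \exists\, C,\rho>0\ \ \forall\, 0<r<R\le\rho\ \ \forall\, x\in E:\ N_r\big(B(x,R)\cap E\big)\le C\Big(\frac Rr\Big)^{\alpha}\Big\},$$ where $B(x,R)$ is the closed ball of radius $R$ about $x$. Theorem. $F$ is non-empty with positive probability and, conditioned on $F$ being non-empty, almost surely $$\dim_{\mathrm A}F=d$$ and, simultaneously for all $0\le k\le d$ and all $k$-dimensional linear subspaces $V\subseteq\mathbb{R}^d$, $$\dim_{\mathrm A}\pi_V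 F=k,$$ where $\pi_V$ denotes the orthogonal projection of $\mathbb{R}^d$ onto $V$. -/

import Mathlib

open MeasureTheory ProbabilityTheory Set
open scoped ENNReal NNReal

/-- The smallest number of sets of diameter at most `r` required to cover `A`
(`⊤` if no finite cover exists). -/
noncomputable def coverNumber {X : Type*} [MetricSpace X] (r : ℝ) (A : Set X) : ℕ∞ :=
  ⨅ (U : Set (Set X)) (_ : ∀ u ∈ U, Metric.ediam u ≤ ENNReal.ofReal r) (_ : A ⊆ ⋃₀ U), U.encard

/-- `α` is an admissible exponent for `F`: there are `C, ρ > 0` such that for all `0 < r < R ≤ ρ`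
and all `x ∈ F`, one has `N_r (B(x, R) ∩ F) ≤ C (R / r) ^ α`. -/
def IsAssouadExponent {X : Type*} [MetricSpace X] (F : Set X) (α : ℝ≥0) : Prop :=
  ∃ C ρ : ℝ, 0 < C ∧ 0 < ρ ∧ ∀ r R : ℝ, 0 < r → r < R → R ≤ ρ → ∀ x ∈ F,
    (coverNumber r (Metric.closedBall x R ∩ F) : ℝ≥0∞) ≤ ENNReal.ofReal (C * (R / r) ^ (α : ℝ))

/-- The Assouad dimension, the infimum of the admissible exponents. (No negative exponent is
admissible for a non-empty set.) -/
noncomputable def assouadDim {X : Type*} [MetricSpace X] (F : Set X) : ℝ≥0∞ :=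
  ⨅ (α : ℝ≥0) (_ : IsAssouadExponent F α), (α : ℝ≥0∞)

/-- The position of one of the `n ^ d` subcubes within its parent cube. -/
abbrev SubPos (d n : ℕ) : Type := Fin d → Fin n

/-- The mesh cube of side length `n ^ (-m)` reached from `[0,1]^d` along the word `w` of length `m`:
the first letter selects a subcube of `[0,1]^d`, the second letter a subcube of that one, etc. -/
def meshCube {d n : ℕ} (w : List (SubPos d n)) : Set (EuclideanSpace ℝ (Fin d)) :=
  {x | ∀ j : Fin d,
    x j ∈ Icc (∑ i : Fin w.length, ((w.get i j : ℕ) : ℝ) / (n : ℝ) ^ ((i : ℕ) + 1))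
      (∑ i : Fin w.length, ((w.get i j : ℕ) : ℝ) / (n : ℝ) ^ ((i : ℕ) + 1)
        + 1 / (n : ℝ) ^ w.length)}

/-- Given the outcomes `c` of the coin tosses, where `c (v, a)` decides whether the subcube at
position `a` of the cube coded by `v` is kept, the cube coded by `w` survives if it and all its
ancestors other than `[0,1]^d` are kept. -/
def Survives {d n : ℕ} (c : List (SubPos d n) × SubPos d n → Bool) (w : List (SubPos d n)) : Prop :=
  ∀ (v : List (SubPos d n)) (a : SubPos d n), v ++ [a] <+: w → c (v, a) = true

/-- `Q_k`, the union of the surviving cubes of level `k`. -/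
def percLevel {d n : ℕ} (c : List (SubPos d n) × SubPos d n → Bool) (k : ℕ) :
    Set (EuclideanSpace ℝ (Fin d)) :=
  ⋃ (w : List (SubPos d n)) (_ : w.length = k ∧ Survives c w), meshCube w

/-- The limit set `F = ⋂ Q_k`. -/
def percSet {d n : ℕ} (c : List (SubPos d n) × SubPos d n → Bool) :
    Set (EuclideanSpace ℝ (Fin d)) :=
  ⋂ k : ℕ, percLevel c k

/-! ### Volume bounds for covering numbers. -/

section Covering

variable {W : Type*} [NormedAddCommGroup W] [InnerProductSpace ℝ W] [FiniteDimensional ℝ W]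

/-! The upper bound holds for every subset of a `k`-dimensional space, by comparing volumes.

For the lower bound, call a cube rich if its next `m` generations are entirely kept and every cube
of the last of them has descendants of all generations. Inside a surviving rich cube of side `s`,
the set `F` is dense at scale `s / n ^ m` up to a constant. A projection is 1-Lipschitz and maps the
inscribed ball of the cube onto a ball of the same radius, so the image is equally dense there and
needs about `(n ^ m) ^ k` sets. Rich cubes for every `m` at arbitrarily small scales thus exclude
exponents below `k` (`finrank_le_assouadDim`, `assouadDim_image_percSet`). This step is
deterministic, so one null set serves all subspaces.

Such cubes exist almost surely on non-extinction (`ae_exists_rich`). A cube is rich with probability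
at least some `γ > 0` depending only on `m`, independently of all tosses that decide whether it
survives. While the process lives, the conditional probability of ever finding a deep surviving rich
cube stays at least `γ`. By Lévy's upward theorem it converges to the indicator of that event, which
must then be 1. -/

lemma coverNumber_le_encard {X : Type*} [MetricSpace X] {r : ℝ} {A : Set X} (U : Set (Set X))
    (hU : ∀ u ∈ U, Metric.ediam u ≤ ENNReal.ofReal r) (hA : A ⊆ ⋃₀ U) :
    coverNumber r A ≤ U.encard :=
  iInf_le_of_le U (iInf_le_of_le hU (iInf_le _ hA))

/-- Volume bound for separated subsets of a ball. -/
lemma card_le_of_separated_in_closedBall (x : W) {R r : ℝ} (hr : 0 < r) (hrR : r < R)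
    (C : Finset W) (hC : ↑C ⊆ Metric.closedBall x R)
    (hsep : (C : Set W).Pairwise fun a b => r / 2 < dist a b) :
    (C.card : ℝ) ≤ (5 * (R / r)) ^ Module.finrank ℝ W := by
  borelize W
  let ν : Measure W := Measure.addHaar
  -- Centres more than `r / 2` apart make balls of radius `r / 4` disjoint; all lie in radius `R + r
  -- / 4 ≤ 5 * R / 4`, whence the factor 5.
  have hdisj : (C : Set W).PairwiseDisjoint fun a => Metric.closedBall a (r / 4) := by
    intro a ha b hb hab
    exact Metric.closedBall_disjoint_closedBall (by linarith [hsep ha hb hab])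
  have hsub : (⋃ a ∈ C, Metric.closedBall a (r / 4)) ⊆ Metric.closedBall x (5 * R / 4) := by
    refine iUnion₂_subset fun a ha => Metric.closedBall_subset_closedBall' ?_
    have := Metric.mem_closedBall.1 (hC ha)
    linarith
  have h1 := measureReal_mono (μ := ν) hsub (measure_closedBall_lt_top.ne)
  rw [measureReal_biUnion_finset hdisj (fun a _ => measurableSet_closedBall)
    (fun a _ => measure_closedBall_lt_top.ne)] at h1
  simp only [Measure.addHaar_real_closedBall ν _ (show 0 ≤ r / 4 by linarith),
    Measure.addHaar_real_closedBall ν _ (show 0 ≤ 5 * R / 4 by linarith), Finset.sum_const,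
    nsmul_eq_mul] at h1
  have hpos : 0 < ν.real (Metric.ball (0 : W) 1) := by
    rw [measureReal_def]
    exact ENNReal.toReal_pos (Metric.measure_ball_pos ν _ one_pos).ne' measure_ball_lt_top.ne
  rw [← mul_assoc] at h1
  have h2 := le_of_mul_le_mul_right h1 hpos
  have h3 : (5 * (R / r)) ^ Module.finrank ℝ W * (r / 4) ^ Module.finrank ℝ W
      = (5 * R / 4) ^ Module.finrank ℝ W := by
    rw [← mul_pow]; congr 1; field_simp
  rw [← h3] at h2
  exact le_of_mul_le_mul_right h2 (by positivity)

/-- Balls of a `k`-dimensional Euclidean space can be covered efficiently. -/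
lemma coverNumber_closedBall_inter_le (E : Set W) (x : W) {R r : ℝ} (hr : 0 < r) (hrR : r < R) :
    (coverNumber r (Metric.closedBall x R ∩ E) : ℝ≥0∞) ≤
      ENNReal.ofReal ((5 * (R / r)) ^ Module.finrank ℝ W) := by
  set B := (5 * (R / r)) ^ Module.finrank ℝ W with hB
  have hR : 0 < R := hr.trans hrR
  have hB0 : 0 ≤ B := by positivity
  obtain ⟨ε, hε⟩ : ∃ ε : ℝ≥0, (ε : ℝ) = r / 2 := ⟨⟨r / 2, by positivity⟩, rfl⟩
  have key : ∀ C : Set W, C ⊆ Metric.closedBall x R → Metric.IsSeparated ε C →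
      C.encard ≤ (⌊B⌋₊ : ℕ∞) := by
    intro C hCs hC
    by_contra! hlt
    -- `C` may be infinite, so a subset of exactly `⌊B⌋₊ + 1` points is extracted first.
    have h1 : ((⌊B⌋₊ + 1 : ℕ) : ℕ∞) ≤ C.encard := by
      push_cast; exact Order.add_one_le_of_lt hlt
    obtain ⟨D, hDC, hD⟩ := exists_subset_encard_eq h1
    have hDf : D.Finite := finite_of_encard_eq_coe hD
    have hsep : D.Pairwise fun a b => r / 2 < dist a b := by
      intro a ha b hb hab
      have : (ε : ℝ≥0∞) < edist a b := hC (hDC ha) (hDC hb) hab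
      rw [edist_nndist, ENNReal.coe_lt_coe, ← NNReal.coe_lt_coe, hε, coe_nndist] at this
      exact this
    have h2 := card_le_of_separated_in_closedBall x hr hrR hDf.toFinset
      (by simpa using hDC.trans hCs) (by simpa using hsep)
    rw [hDf.encard_eq_coe_toFinset_card] at hD
    rw [Nat.cast_inj.1 hD, ← hB] at h2
    have := Nat.lt_floor_add_one B
    push_cast at h2
    linarith
  have hpack : Metric.packingNumber ε (Metric.closedBall x R) ≤ (⌊B⌋₊ : ℕ∞) := by
    simp only [Metric.packingNumber, iSup_le_iff]
    exact fun C h1 h2 => key C h1 h2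
  have hfin : Metric.packingNumber ε (Metric.closedBall x R) ≠ ⊤ :=
    (hpack.trans_lt (ENat.natCast_lt_top _)).ne
  have hcov := Metric.isCover_maximalSeparatedSet hfin
  set S := Metric.maximalSeparatedSet ε (Metric.closedBall x R)
  have hle : coverNumber r (Metric.closedBall x R ∩ E) ≤ (⌊B⌋₊ : ℕ∞) := by
    refine (coverNumber_le_encard ((fun c => Metric.closedBall c (r / 2)) '' S) ?_ ?_).trans
      ((encard_image_le _ _).trans (key S Metric.maximalSeparatedSet_subset
        Metric.isSeparated_maximalSeparatedSet))
    · rintro _ ⟨c, -, rfl⟩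
      refine Metric.ediam_le fun a ha b hb => ?_
      rw [edist_dist]
      apply ENNReal.ofReal_le_ofReal
      have := dist_triangle_right a b c
      simp only [Metric.mem_closedBall] at ha hb
      linarith
    · rintro y ⟨hy, -⟩
      obtain ⟨c, hc, hyc⟩ := hcov hy
      refine ⟨_, ⟨c, hc, rfl⟩, ?_⟩
      change edist y c ≤ ε at hyc
      rw [edist_nndist, ENNReal.coe_le_coe, ← NNReal.coe_le_coe, hε, coe_nndist] at hyc
      exact hyc
  calc (coverNumber r (Metric.closedBall x R ∩ E) : ℝ≥0∞) ≤ ((⌊B⌋₊ : ℕ∞) : ℝ≥0∞) := by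
        exact_mod_cast hle
    _ = ENNReal.ofReal (⌊B⌋₊ : ℝ) := by simp
    _ ≤ ENNReal.ofReal B := ENNReal.ofReal_le_ofReal (Nat.floor_le hB0)

lemma assouadDim_le_finrank (E : Set W) : assouadDim E ≤ Module.finrank ℝ W := by
  have : IsAssouadExponent E (Module.finrank ℝ W : ℝ≥0) := by
    refine ⟨5 ^ Module.finrank ℝ W, 1, by positivity, one_pos, fun r R hr hrR _ x _ => ?_⟩
    have := coverNumber_closedBall_inter_le E x hr hrR
    rw [mul_pow] at this
    simpa using this
  exact (iInf₂_le (Module.finrank ℝ W : ℝ≥0) this).trans (by simp)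

/-- Covering numbers of a set which is `r`-dense in a ball are large. -/
lemma le_coverNumber_of_dense {A : Set W} {y : W} {r t : ℝ} (hr : 0 < r) (ht : 0 < t)
    (hA : ∀ z ∈ Metric.closedBall y t, ∃ a ∈ A, dist z a ≤ r) :
    ENNReal.ofReal ((t / (2 * r)) ^ Module.finrank ℝ W) ≤ (coverNumber r A : ℝ≥0∞) := by
  borelize W
  let ν : Measure W := Measure.addHaar
  by_cases htop : coverNumber r A = ⊤
  · simp [htop]
  suffices H : ∀ U : Set (Set W), (∀ u ∈ U, Metric.ediam u ≤ ENNReal.ofReal r) → A ⊆ ⋃₀ U →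
      ENNReal.ofReal ((t / (2 * r)) ^ Module.finrank ℝ W) ≤ (U.encard : ℝ≥0∞) by
    -- Rounding up moves the bound into `ℕ∞`, where the infimum over covers is taken.
    have h2 : ((⌈(t / (2 * r)) ^ Module.finrank ℝ W⌉₊ : ℕ) : ℕ∞) ≤ coverNumber r A := by
      refine le_iInf fun U => le_iInf fun hU => le_iInf fun hAU => ?_
      by_cases hUt : U.encard = ⊤
      · simp [hUt]
      have h3 := H U hU hAU
      obtain ⟨N, hN⟩ := ENat.ne_top_iff_exists.1 hUt
      rw [← hN] at h3 ⊢
      rw [ENat.toENNReal_coe, ENNReal.ofReal_le_natCast] at h3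
      exact_mod_cast Nat.ceil_le.2 h3
    calc _ ≤ ENNReal.ofReal (⌈(t / (2 * r)) ^ Module.finrank ℝ W⌉₊ : ℝ) :=
          ENNReal.ofReal_le_ofReal (Nat.le_ceil _)
      _ = ((⌈(t / (2 * r)) ^ Module.finrank ℝ W⌉₊ : ℕ∞) : ℝ≥0∞) := by simp
      _ ≤ _ := by exact_mod_cast h2
  intro U hU hAU
  by_cases hUt : U.encard = ⊤
  · simp [hUt]
  have hUf : U.Finite := encard_ne_top_iff.1 hUt
  have hcentre : ∀ u : Set W, ∃ c : W, u ∈ U → u ⊆ Metric.closedBall c r := by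
    intro u
    rcases u.eq_empty_or_nonempty with rfl | ⟨c, hc⟩
    · exact ⟨0, fun _ => empty_subset _⟩
    · refine ⟨c, fun hu b hb => ?_⟩
      have := (Metric.edist_le_ediam_of_mem hb hc).trans (hU u hu)
      rw [edist_dist] at this
      exact (ENNReal.ofReal_le_ofReal_iff hr.le).1 this
  choose c hc using hcentre
  have hcov : Metric.closedBall y t ⊆ ⋃ u ∈ hUf.toFinset, Metric.closedBall (c u) (2 * r) := by
    intro z hz
    obtain ⟨a, haA, hza⟩ := hA z hz
    obtain ⟨u, hu, hau⟩ := hAU haA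
    refine mem_iUnion₂.2 ⟨u, by simpa using hu, ?_⟩
    have h1 := Metric.mem_closedBall.1 (hc u hu hau)
    have := dist_triangle z a (c u)
    rw [Metric.mem_closedBall]; linarith
  have h1 := (measure_mono (μ := ν) hcov).trans (measure_biUnion_finset_le _ _)
  simp only [Measure.addHaar_closedBall ν _ ht.le,
    Measure.addHaar_closedBall ν _ (show 0 ≤ 2 * r by linarith), Finset.sum_const,
    nsmul_eq_mul] at h1
  rw [← mul_assoc] at h1
  have h2 := (ENNReal.mul_le_mul_iff_left (Metric.measure_ball_pos ν (0 : W) one_pos).ne'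
    measure_ball_lt_top.ne).1 h1
  rw [hUf.encard_eq_coe_toFinset_card, div_pow, ENNReal.ofReal_div_of_pos (by positivity)]
  refine ENNReal.div_le_of_le_mul ?_
  simpa using h2

/-- A set which at arbitrarily small scales is relatively dense in balls has full Assouad
dimension. -/
lemma finrank_le_assouadDim {E : Set W} (b n : ℕ) (hn : 2 ≤ n) (hb : 0 < b)
    (h : ∀ m : ℕ, 0 < m → ∀ ρ : ℝ, 0 < ρ → ∃ R : ℝ, 0 < R ∧ R ≤ ρ ∧ ∃ x ∈ E, ∃ y : W,
      ∀ z ∈ Metric.closedBall y (R / b), ∃ a ∈ Metric.closedBall x R ∩ E,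
        dist z a ≤ R / (n : ℝ) ^ m) :
    (Module.finrank ℝ W : ℝ≥0∞) ≤ assouadDim E := by
  refine le_iInf₂ fun α hα => ?_
  obtain ⟨C, ρ, hC, hρ, H⟩ := hα
  set k := Module.finrank ℝ W
  by_contra! hlt
  have hlt' : (α : ℝ) < k := by
    have : α < (k : ℝ≥0) := by
      rw [← ENNReal.coe_lt_coe]; simpa using hlt
    exact_mod_cast this
  have hn1 : (1 : ℝ) < n := by exact_mod_cast hn
  have hn0 : (0 : ℝ) < n := by linarith
  have hb' : (0 : ℝ) < b := by exact_mod_cast hb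
  -- The right side does not depend on `m`, while `α < k` makes the left side unbounded.
  have key : ∀ m : ℕ, 0 < m → ((n : ℝ) ^ ((k : ℝ) - α)) ^ m ≤ C * (2 * b) ^ k := by
    intro m hm
    obtain ⟨R, hR, hRρ, x, hx, y, hy⟩ := h m hm ρ hρ
    have hnm : (1 : ℝ) < (n : ℝ) ^ m := one_lt_pow₀ hn1 hm.ne'
    have hr : 0 < R / (n : ℝ) ^ m := by positivity
    have h1 := H (R / (n : ℝ) ^ m) R hr (div_lt_self hR hnm) hRρ x hx
    have h2 := (le_coverNumber_of_dense hr (by positivity) hy).trans h1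
    have e1 : R / b / (2 * (R / (n : ℝ) ^ m)) = (n : ℝ) ^ m / (2 * b) := by field_simp
    have e2 : R / (R / (n : ℝ) ^ m) = (n : ℝ) ^ m := by field_simp
    rw [e1, e2, ENNReal.ofReal_le_ofReal_iff (by positivity), div_pow,
      div_le_iff₀ (by positivity)] at h2
    have e3 : ((n : ℝ) ^ ((k : ℝ) - α)) ^ m = ((n : ℝ) ^ m) ^ k / ((n : ℝ) ^ m) ^ (α : ℝ) := by
      rw [← Real.rpow_natCast (((n : ℝ) ^ m)), ← Real.rpow_sub (by positivity),
        ← Real.rpow_natCast (n : ℝ) m, ← Real.rpow_mul hn0.le, ← Real.rpow_natCast,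
        ← Real.rpow_mul hn0.le, mul_comm]
    rw [e3, div_le_iff₀ (by positivity)]
    linarith
  have hbig : 1 < (n : ℝ) ^ ((k : ℝ) - α) := Real.one_lt_rpow hn1 (by linarith)
  obtain ⟨m, hm⟩ := pow_unbounded_of_one_lt (C * (2 * b) ^ k) hbig
  have h3 := key (m + 1) m.succ_pos
  have h4 : ((n : ℝ) ^ ((k : ℝ) - α)) ^ m ≤ ((n : ℝ) ^ ((k : ℝ) - α)) ^ (m + 1) :=
    pow_le_pow_right₀ hbig.le (Nat.le_succ m)
  linarith

end Covering

/-! ### Geometry of the mesh cubes. -/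

section Cubes

variable {d n : ℕ}

/-- The lower corner of a mesh cube. -/
noncomputable def meshCorner (w : List (SubPos d n)) (j : Fin d) : ℝ :=
  ∑ i : Fin w.length, ((w.get i j : ℕ) : ℝ) / (n : ℝ) ^ ((i : ℕ) + 1)

lemma mem_meshCube {w : List (SubPos d n)} {x : EuclideanSpace ℝ (Fin d)} :
    x ∈ meshCube w ↔
      ∀ j, x j ∈ Icc (meshCorner w j) (meshCorner w j + 1 / (n : ℝ) ^ w.length) := Iff.rfl

lemma meshCorner_concat (w : List (SubPos d n)) (a : SubPos d n) (j : Fin d) :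
    meshCorner (w ++ [a]) j = meshCorner w j + ((a j : ℕ) : ℝ) / (n : ℝ) ^ (w.length + 1) := by
  have key : ∀ v : List (SubPos d n), meshCorner v j = ∑ i ∈ Finset.range v.length,
      if h : i < v.length then ((v[i] j : ℕ) : ℝ) / (n : ℝ) ^ (i + 1) else 0 := by
    intro v
    rw [Finset.sum_range]
    simp [meshCorner]
  rw [key, key, show Finset.range (w ++ [a]).length = Finset.range (w.length + 1) by simp,
    Finset.sum_range_succ]
  congr 1
  · refine Finset.sum_congr rfl fun i hi => ?_
    have hi := Finset.mem_range.1 hi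
    simp [hi, hi.trans (Nat.lt_succ_self _), List.getElem_append_left hi]
  · simp

lemma meshCube_concat_subset (w : List (SubPos d n)) (a : SubPos d n) :
    meshCube (w ++ [a]) ⊆ meshCube w := by
  intro x hx
  rw [mem_meshCube] at hx ⊢
  intro j
  have h := hx j
  rw [meshCorner_concat, List.length_append, List.length_singleton] at h
  have hn : 0 < n := (a j).pos
  have hn' : (0 : ℝ) < n := by exact_mod_cast hn
  have ha : ((a j : ℕ) : ℝ) + 1 ≤ n := by exact_mod_cast (a j).isLt
  have h1 : 0 ≤ ((a j : ℕ) : ℝ) / (n : ℝ) ^ (w.length + 1) := by positivity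
  have h2 : ((a j : ℕ) : ℝ) / (n : ℝ) ^ (w.length + 1) + 1 / (n : ℝ) ^ (w.length + 1)
      ≤ 1 / (n : ℝ) ^ w.length := by
    rw [← add_div, div_le_div_iff₀ (by positivity) (by positivity), pow_succ]
    nlinarith [pow_pos hn' w.length]
  exact ⟨by linarith [h.1], by linarith [h.2]⟩

lemma exists_mem_meshCube_concat (hn : 0 < n) {w : List (SubPos d n)}
    {y : EuclideanSpace ℝ (Fin d)} (hy : y ∈ meshCube w) : ∃ a, y ∈ meshCube (w ++ [a]) := by
  have hn' : (0 : ℝ) < n := by exact_mod_cast hn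
  have hP : (0 : ℝ) < (n : ℝ) ^ (w.length + 1) := by positivity
  have hj : ∀ j, ∃ b : Fin n,
      ((b : ℕ) : ℝ) ≤ (y j - meshCorner w j) * (n : ℝ) ^ (w.length + 1) ∧
      (y j - meshCorner w j) * (n : ℝ) ^ (w.length + 1) ≤ ((b : ℕ) : ℝ) + 1 := by
    intro j
    have h := mem_meshCube.1 hy j
    set t := (y j - meshCorner w j) * (n : ℝ) ^ (w.length + 1) with ht
    have ht0 : 0 ≤ t := mul_nonneg (by linarith [h.1]) hP.le
    have htn : t ≤ n := by
      have : t ≤ 1 / (n : ℝ) ^ w.length * (n : ℝ) ^ (w.length + 1) :=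
        mul_le_mul_of_nonneg_right (by linarith [h.2]) hP.le
      refine this.trans_eq ?_
      rw [pow_succ]; field_simp
    by_cases hlt : ⌊t⌋₊ < n
    · exact ⟨⟨⌊t⌋₊, hlt⟩, Nat.floor_le ht0, (Nat.lt_floor_add_one t).le⟩
    -- On the upper face `t = n`, and the point belongs to the last subcube.
    · have hnt : (n : ℝ) ≤ t := (Nat.le_floor_iff ht0).1 (not_lt.1 hlt)
      refine ⟨⟨n - 1, by omega⟩, ?_, ?_⟩ <;> simp only [Nat.cast_sub hn, Nat.cast_one] <;> linarith
  choose a ha using hj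
  refine ⟨a, mem_meshCube.2 fun j => ?_⟩
  obtain ⟨h1, h2⟩ := ha j
  rw [meshCorner_concat, List.length_append, List.length_singleton]
  rw [← div_le_iff₀ hP] at h1
  rw [← le_div_iff₀ hP, add_div] at h2
  exact ⟨by linarith, by linarith⟩

lemma isCompact_meshCube (w : List (SubPos d n)) : IsCompact (meshCube w) := by
  have : meshCube w = (EuclideanSpace.equiv (Fin d) ℝ).toHomeomorph ⁻¹'
      (Set.univ.pi fun j => Icc (meshCorner w j) (meshCorner w j + 1 / (n : ℝ) ^ w.length)) := by
    ext x
    rw [mem_meshCube, mem_preimage, mem_univ_pi]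
    rfl
  rw [this, Homeomorph.isCompact_preimage]
  exact isCompact_univ_pi fun j => isCompact_Icc

lemma exists_closedBall_subset_meshCube (w : List (SubPos d n)) :
    ∃ z, Metric.closedBall z (1 / (n : ℝ) ^ w.length / 2) ⊆ meshCube w := by
  refine ⟨WithLp.toLp 2 fun j => meshCorner w j + 1 / (n : ℝ) ^ w.length / 2, fun x hx => ?_⟩
  refine mem_meshCube.2 fun j => ?_
  rw [Metric.mem_closedBall, dist_eq_norm] at hx
  have := (PiLp.norm_apply_le _ j).trans hx
  simp only [PiLp.sub_apply, Real.norm_eq_abs, abs_le] at this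
  exact ⟨by linarith [this.1], by linarith [this.2]⟩

lemma meshCube_nonempty (w : List (SubPos d n)) : (meshCube w).Nonempty := by
  obtain ⟨z, hz⟩ := exists_closedBall_subset_meshCube w
  exact ⟨z, hz (Metric.mem_closedBall_self (by positivity))⟩

lemma dist_le_of_mem_meshCube {w : List (SubPos d n)} {x y : EuclideanSpace ℝ (Fin d)}
    (hx : x ∈ meshCube w) (hy : y ∈ meshCube w) : dist x y ≤ d / (n : ℝ) ^ w.length := by
  set s : ℝ := 1 / (n : ℝ) ^ w.length with hs
  have hs0 : 0 ≤ s := by positivity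
  have hds : (d : ℝ) / (n : ℝ) ^ w.length = d * s := by rw [hs]; ring
  rw [EuclideanSpace.dist_eq, hds]
  refine Real.sqrt_le_iff.2 ⟨by positivity, ?_⟩
  -- The crude diameter bound `d * s` replaces `√d * s`.
  have hd : (d : ℝ) ≤ (d : ℝ) ^ 2 := by exact_mod_cast Nat.le_self_pow two_ne_zero d
  calc ∑ j, dist (x j) (y j) ^ 2 ≤ ∑ _j : Fin d, s ^ 2 := by
        refine Finset.sum_le_sum fun j _ => pow_le_pow_left₀ dist_nonneg ?_ 2
        refine (Real.dist_le_of_mem_Icc (mem_meshCube.1 hx j) (mem_meshCube.1 hy j)).trans_eq ?_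
        ring
    _ = d * s ^ 2 := by simp
    _ ≤ (d * s) ^ 2 := by rw [mul_pow]; exact mul_le_mul_of_nonneg_right hd (by positivity)

/-! ### Survival, the limit set and rich cubes. -/

variable {c : List (SubPos d n) × SubPos d n → Bool}

lemma survives_concat_iff {w : List (SubPos d n)} {a : SubPos d n} :
    Survives c (w ++ [a]) ↔ Survives c w ∧ c (w, a) = true := by
  constructor
  · exact fun h => ⟨fun v b hv => h v b (hv.trans (List.prefix_append _ _)),
      h w a List.prefix_rfl⟩
  · rintro ⟨h1, h2⟩ v b hv
    rcases List.prefix_concat_iff.1 hv with h | h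
    · obtain ⟨rfl, h⟩ := List.append_inj' h rfl
      obtain rfl : b = a := by simpa using h
      exact h2
    · exact h1 v b h

lemma survives_nil : Survives c [] := fun v a h => by simp at h

lemma percLevel_succ_subset (k : ℕ) : percLevel c (k + 1) ⊆ percLevel c k := by
  refine iUnion₂_subset fun w ⟨hw, hs⟩ => ?_
  obtain rfl | ⟨v, a, rfl⟩ := List.eq_nil_or_concat' w
  · simp at hw
  · exact (meshCube_concat_subset v a).trans (subset_iUnion₂_of_subset v
      ⟨by simpa using hw, (survives_concat_iff.1 hs).1⟩ subset_rfl)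

/-- A cube with surviving descendants of every generation meets the limit set. -/
lemma meshCube_inter_percSet_nonempty {w : List (SubPos d n)}
    (h : ∀ k : ℕ, ∃ v : List (SubPos d n), v.length = w.length + k ∧ w <+: v ∧ Survives c v) :
    (meshCube w ∩ percSet c).Nonempty := by
  -- Cantor's intersection theorem applies to the unions over `I k`, which are nested, compact and
  -- non-empty; `I 0` contains at most `w`, so the common point lies in its cube.
  set I : ℕ → Set (List (SubPos d n)) :=
    fun k => {v | v.length = w.length + k ∧ w <+: v ∧ Survives c v}
  have hI : ∀ k, (I k).Finite := fun k =>
    (List.finite_length_eq (SubPos d n) (w.length + k)).subset fun v hv => hv.1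
  have hK : ∀ k, IsCompact (⋃ v ∈ I k, meshCube v) := fun k =>
    (hI k).isCompact_biUnion fun v _ => isCompact_meshCube v
  have hsub : ∀ k, ⋃ v ∈ I (k + 1), meshCube v ⊆ ⋃ v ∈ I k, meshCube v := by
    intro k
    refine iUnion₂_subset fun v ⟨hv, ⟨t, ht⟩, hs⟩ => ?_
    obtain rfl | ⟨t, a, rfl⟩ := List.eq_nil_or_concat' t
    · simp [← ht] at hv
    · rw [← List.append_assoc] at ht
      subst ht
      exact (meshCube_concat_subset _ a).trans (subset_iUnion₂_of_subset (w ++ t)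
        ⟨by simp at hv ⊢; omega, List.prefix_append _ _, (survives_concat_iff.1 hs).1⟩ subset_rfl)
  have hne : ∀ k, (⋃ v ∈ I k, meshCube v).Nonempty := by
    intro k
    obtain ⟨v, hv⟩ := h k
    obtain ⟨x, hx⟩ := meshCube_nonempty v
    exact ⟨x, mem_iUnion₂.2 ⟨v, hv, hx⟩⟩
  obtain ⟨x, hx⟩ := IsCompact.nonempty_iInter_of_sequence_nonempty_isCompact_isClosed
    (fun k => ⋃ v ∈ I k, meshCube v) hsub hne (hK 0) (fun k => (hK k).isClosed)
  rw [mem_iInter] at hx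
  refine ⟨x, ?_, mem_iInter.2 fun k => ?_⟩
  · obtain ⟨v, hv, hxv⟩ := mem_iUnion₂.1 (hx 0)
    rwa [hv.2.1.eq_of_length hv.1.symm]
  · have hanti : Antitone (percLevel c) := antitone_nat_of_succ_le percLevel_succ_subset
    obtain ⟨v, hv, hxv⟩ := mem_iUnion₂.1 (hx k)
    exact hanti (Nat.le_add_left k w.length) (mem_iUnion₂.2 ⟨v, ⟨hv.1, hv.2.2⟩, hxv⟩)

lemma percSet_nonempty_iff :
    (percSet c).Nonempty ↔ ∀ k, ∃ w : List (SubPos d n), w.length = k ∧ Survives c w := by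
  constructor
  · rintro ⟨x, hx⟩ k
    obtain ⟨w, hw, -⟩ := mem_iUnion₂.1 (mem_iInter.1 hx k)
    exact ⟨w, hw⟩
  · intro h
    refine (meshCube_inter_percSet_nonempty (w := []) fun k => ?_).mono inter_subset_right
    obtain ⟨w, hw, hs⟩ := h k
    exact ⟨w, by simpa using hw, List.nil_prefix, hs⟩

/-- The cube coded by `w` has descendants of generation `k`, all coin tosses up to `w` being
disregarded. -/
def Alive (c : List (SubPos d n) × SubPos d n → Bool) : ℕ → List (SubPos d n) → Prop
  | 0, _ => True
  | k + 1, w => ∃ a, c (w, a) = true ∧ Alive c k (w ++ [a])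

/-- All descendants of `w` in the next `m` generations are kept, and those of generation `m` have
descendants of every generation. -/
def Rich (c : List (SubPos d n) × SubPos d n → Bool) : ℕ → List (SubPos d n) → Prop
  | 0, w => ∀ k, Alive c k w
  | m + 1, w => ∀ a, c (w, a) = true ∧ Rich c m (w ++ [a])

lemma Alive.exists_survives {k : ℕ} {w : List (SubPos d n)} (h : Alive c k w)
    (hs : Survives c w) :
    ∃ v : List (SubPos d n), v.length = w.length + k ∧ w <+: v ∧ Survives c v := by
  induction k generalizing w with
  | zero => exact ⟨w, rfl, List.prefix_rfl, hs⟩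
  | succ k ih =>
    obtain ⟨a, ha, h⟩ := h
    obtain ⟨v, hv, hp, hvs⟩ := ih h (survives_concat_iff.2 ⟨hs, ha⟩)
    refine ⟨v, ?_, (List.prefix_append _ _).trans hp, hvs⟩
    simp at hv; omega

/-- Follow `y` down through `m` generations of subcubes, all kept; the last one meets the limit set
and bounds the distance by its diameter. -/
lemma Rich.exists_mem_percSet (hn : 0 < n) {m : ℕ} {w : List (SubPos d n)} (h : Rich c m w)
    (hs : Survives c w) {y : EuclideanSpace ℝ (Fin d)} (hy : y ∈ meshCube w) :
    ∃ x ∈ meshCube w ∩ percSet c, dist y x ≤ d / (n : ℝ) ^ (w.length + m) := by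
  induction m generalizing w with
  | zero =>
    obtain ⟨x, hx⟩ := meshCube_inter_percSet_nonempty fun k => (h k).exists_survives hs
    exact ⟨x, hx, dist_le_of_mem_meshCube hy hx.1⟩
  | succ m ih =>
    obtain ⟨a, ha⟩ := exists_mem_meshCube_concat hn hy
    obtain ⟨x, hx, hd⟩ := ih (h a).2 (survives_concat_iff.2 ⟨hs, (h a).1⟩) ha
    refine ⟨x, ⟨meshCube_concat_subset _ _ hx.1, hx.2⟩, hd.trans_eq ?_⟩
    rw [List.length_append, List.length_singleton, add_assoc, add_comm 1 m]

variable {W : Type*} [NormedAddCommGroup W] [InnerProductSpace ℝ W] [FiniteDimensional ℝ W]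

/-- If rich cubes occur at arbitrarily small scales, then the images of the limit set under
norm-nonincreasing linear surjections have full Assouad dimension. -/
lemma assouadDim_image_percSet (hn : 2 ≤ n) (hd : 0 < d)
    (h : ∀ m L : ℕ, ∃ w : List (SubPos d n), L ≤ w.length ∧ Survives c w ∧ Rich c m w)
    (T : EuclideanSpace ℝ (Fin d) →ₗ[ℝ] W) (hT : ∀ x, ‖T x‖ ≤ ‖x‖)
    (g : W → EuclideanSpace ℝ (Fin d)) (hg : ∀ y, ‖g y‖ ≤ ‖y‖) (hTg : ∀ y, T (g y) = y) :
    assouadDim (T '' percSet c) = Module.finrank ℝ W := by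
  have hn0 : 0 < n := by omega
  have hn' : (0 : ℝ) < n := by exact_mod_cast hn0
  have hn1 : (1 : ℝ) < n := by exact_mod_cast hn
  have hd' : (0 : ℝ) < d := by exact_mod_cast hd
  have hdist : ∀ x y, dist (T x) (T y) ≤ dist x y := fun x y => by
    rw [dist_eq_norm, dist_eq_norm, ← map_sub]; exact hT _
  refine le_antisymm (assouadDim_le_finrank _)
    (finrank_le_assouadDim (2 * d) n hn (by omega) fun m _ ρ hρ => ?_)
  obtain ⟨L, hL⟩ := pow_unbounded_of_one_lt (d / ρ) hn1
  obtain ⟨w, hwL, hs, hr⟩ := h m L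
  obtain ⟨z, hz⟩ := exists_closedBall_subset_meshCube w
  obtain ⟨p, hp, -⟩ := hr.exists_mem_percSet hn0 hs (hz (Metric.mem_closedBall_self (by positivity)))
  -- `R` bounds the diameter of the cube, so the `R`-ball about `T p` contains the cube's whole
  -- image; `R / (2 * d)` is the radius of the inscribed ball.
  refine ⟨d / (n : ℝ) ^ w.length, by positivity, ?_, T p, mem_image_of_mem _ hp.2, T z,
    fun y hy => ?_⟩
  · rw [div_lt_iff₀ hρ] at hL
    rw [div_le_iff₀ (by positivity)]
    have : (n : ℝ) ^ L ≤ (n : ℝ) ^ w.length := pow_le_pow_right₀ hn1.le hwL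
    nlinarith
  -- A preimage of `y` under `T`, no farther from `z` than `y` is from `T z`.
  · have hq : z + g (y - T z) ∈ meshCube w := by
      apply hz
      rw [Metric.mem_closedBall, dist_eq_norm, add_sub_cancel_left]
      refine (hg _).trans ?_
      rw [← dist_eq_norm]
      refine (Metric.mem_closedBall.1 hy).trans_eq ?_
      push_cast; field_simp
    obtain ⟨f, hf, hqf⟩ := hr.exists_mem_percSet hn0 hs hq
    refine ⟨T f, ⟨?_, mem_image_of_mem _ hf.2⟩, ?_⟩
    · exact (hdist _ _).trans (dist_le_of_mem_meshCube hf.1 hp.1)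
    · have hy' : y = T (z + g (y - T z)) := by rw [map_add, hTg]; abel
      rw [div_div, ← pow_add]
      refine le_trans ?_ hqf
      conv_lhs => rw [hy']
      exact hdist _ _

end Cubes

/-! ### Measurability and independence of the coin tosses. -/

section Probability

variable {Ω : Type*} {d n : ℕ}

/-- The `σ`-algebra generated by the coin tosses with index in `T`. -/
abbrev coinSigma (keep : List (SubPos d n) × SubPos d n → Ω → Bool)
    (T : Set (List (SubPos d n) × SubPos d n)) : MeasurableSpace Ω :=
  ⨆ q ∈ T, MeasurableSpace.comap (keep q) inferInstance

/-- The indices of the coin tosses performed inside the cube coded by `w`. -/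
def below (w : List (SubPos d n)) : Set (List (SubPos d n) × SubPos d n) := {q | w <+: q.1}

variable {keep : List (SubPos d n) × SubPos d n → Ω → Bool}

lemma coinSigma_mono {S T : Set (List (SubPos d n) × SubPos d n)} (h : S ⊆ T) :
    coinSigma keep S ≤ coinSigma keep T :=
  biSup_mono h

lemma measurableSet_coin {T : Set (List (SubPos d n) × SubPos d n)}
    {q : List (SubPos d n) × SubPos d n} (hq : q ∈ T) :
    MeasurableSet[coinSigma keep T] {ω | keep q ω = true} :=
  le_biSup (fun q => MeasurableSpace.comap (keep q) inferInstance) hq _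
    ⟨{true}, trivial, rfl⟩

lemma below_concat_subset (w : List (SubPos d n)) (a : SubPos d n) :
    below (w ++ [a]) ⊆ below w := fun _ hq => (List.prefix_append _ _).trans hq

lemma mem_below_self (w : List (SubPos d n)) (a : SubPos d n) : (w, a) ∈ below w :=
  List.prefix_rfl

/-- Tosses above `w` are disregarded by `Alive`, which is what later yields independence from the
survival of `w`. -/
lemma measurableSet_alive (k : ℕ) (w : List (SubPos d n)) :
    MeasurableSet[coinSigma keep (below w)] {ω | Alive (fun q => keep q ω) k w} := by
  induction k generalizing w with
  | zero => simp [Alive]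
  | succ k ih =>
    simp only [Alive, ofPred_exists, ofPred_and]
    exact .iUnion fun a => (measurableSet_coin (mem_below_self w a)).inter
      (coinSigma_mono (below_concat_subset w a) _ (ih _))

lemma measurableSet_rich (m : ℕ) (w : List (SubPos d n)) :
    MeasurableSet[coinSigma keep (below w)] {ω | Rich (fun q => keep q ω) m w} := by
  induction m generalizing w with
  | zero =>
    simp only [Rich, ofPred_forall]
    exact .iInter fun k => measurableSet_alive k w
  | succ m ih =>
    simp only [Rich, ofPred_forall, ofPred_and]
    exact .iInter fun a => (measurableSet_coin (mem_below_self w a)).inter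
      (coinSigma_mono (below_concat_subset w a) _ (ih _))

lemma measurableSet_survives {w : List (SubPos d n)}
    {T : Set (List (SubPos d n) × SubPos d n)} (h : {q | q.1.length < w.length} ⊆ T) :
    MeasurableSet[coinSigma keep T] {ω | Survives (fun q => keep q ω) w} := by
  simp only [Survives, ofPred_forall]
  refine .iInter fun v => .iInter fun a => .iInter fun hv => measurableSet_coin (h ?_)
  have := hv.length_le
  simp at this ⊢; omega

lemma Alive.of_succ {c : List (SubPos d n) × SubPos d n → Bool} {k : ℕ}
    {w : List (SubPos d n)} (h : Alive c (k + 1) w) : Alive c k w := by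
  induction k generalizing w with
  | zero => trivial
  | succ k ih =>
    obtain ⟨a, ha, h⟩ := h
    exact ⟨a, ha, ih h⟩

lemma measurableSet_child (w : List (SubPos d n)) (a : SubPos d n) {D : Set Ω}
    (hD : MeasurableSet[coinSigma keep (below (w ++ [a]))] D) :
    MeasurableSet[coinSigma keep (insert (w, a) (below (w ++ [a])))]
      ({ω | keep (w, a) ω = true} ∩ D) :=
  (measurableSet_coin (mem_insert _ _)).inter (coinSigma_mono (subset_insert _ _) _ hD)

variable [mΩ : MeasurableSpace Ω] {μ : Measure Ω}

lemma coinSigma_le (hmeas : ∀ q, Measurable (keep q))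
    (T : Set (List (SubPos d n) × SubPos d n)) : coinSigma keep T ≤ mΩ :=
  iSup₂_le fun q _ => (hmeas q).comap_le

lemma measurableSet_percSet_nonempty (hmeas : ∀ q, Measurable (keep q)) :
    MeasurableSet {ω | (percSet (fun q => keep q ω)).Nonempty} := by
  simp only [percSet_nonempty_iff, ofPred_forall, ofPred_exists, ofPred_and]
  refine .iInter fun k => .iUnion fun w => (MeasurableSet.const _).inter ?_
  exact coinSigma_le hmeas univ _ (measurableSet_survives (subset_univ _))

lemma indep_coinSigma (hmeas : ∀ q, Measurable (keep q)) (hindep : iIndepFun keep μ)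
    {S T : Set (List (SubPos d n) × SubPos d n)} (hST : Disjoint S T) :
    Indep (coinSigma keep S) (coinSigma keep T) μ :=
  indep_iSup_of_disjoint (fun q => (hmeas q).comap_le) hindep.iIndep hST

lemma measureReal_inter_of_disjoint (hmeas : ∀ q, Measurable (keep q))
    (hindep : iIndepFun keep μ) {S T : Set (List (SubPos d n) × SubPos d n)}
    (hST : Disjoint S T) {A B : Set Ω} (hA : MeasurableSet[coinSigma keep S] A)
    (hB : MeasurableSet[coinSigma keep T] B) : μ.real (A ∩ B) = μ.real A * μ.real B := by
  simp only [measureReal_def, (Indep_iff _ _ μ).1 (indep_coinSigma hmeas hindep hST) A B hA hB,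
    ENNReal.toReal_mul]

variable [IsProbabilityMeasure μ]

lemma measureReal_biInter_of_disjoint (hmeas : ∀ q, Measurable (keep q))
    (hindep : iIndepFun keep μ) {ι : Type*} {T : ι → Set (List (SubPos d n) × SubPos d n)}
    (hT : Pairwise (Function.onFun Disjoint T)) {A : ι → Set Ω}
    (hA : ∀ i, MeasurableSet[coinSigma keep (T i)] (A i)) (s : Finset ι) :
    μ.real (⋂ i ∈ s, A i) = ∏ i ∈ s, μ.real (A i) := by
  classical
  induction s using Finset.induction_on with
  | empty => simp
  | insert i s hi ih =>
    rw [Finset.set_biInter_insert, Finset.prod_insert hi, ← ih]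
    refine measureReal_inter_of_disjoint (T := ⋃ j ∈ s, T j) hmeas hindep ?_ (hA i)
      (.biInter s.countable_toSet fun j hj => coinSigma_mono (subset_biUnion_of_mem hj) _ (hA j))
    rw [disjoint_iUnion₂_right]
    exact fun j hj => hT (by rintro rfl; exact hi hj)

lemma disjoint_child_below (w : List (SubPos d n)) :
    Pairwise (Function.onFun Disjoint fun a : SubPos d n => insert (w, a) (below (w ++ [a]))) := by
  intro a b hab
  refine disjoint_left.2 ?_
  have hlen : ∀ (v : List (SubPos d n)) (x y : SubPos d n), (v, y) ∉ below (v ++ [x]) :=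
    fun v x y h => by simpa using List.IsPrefix.length_le h
  rintro q (rfl | ha) (h | hb)
  · exact hab (Prod.ext_iff.1 h).2
  · exact hlen _ _ _ hb
  · rw [h] at ha; exact hlen _ _ _ ha
  · have := List.prefix_of_prefix_length_le ha hb (by simp)
    have := this.eq_of_length (by simp)
    exact hab (by simpa using this)

/-! ### Branching process estimates and the zero-one argument. -/

section Branching

variable {p : ℝ} (hp : p ∈ Ioo (0 : ℝ) 1) (hmeas : ∀ q, Measurable (keep q))
  (hindep : iIndepFun keep μ) (hlaw : ∀ q, μ {ω | keep q ω = true} = ENNReal.ofReal p)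
include hp hmeas hindep hlaw

omit [IsProbabilityMeasure μ] in
lemma measureReal_child (w : List (SubPos d n)) (a : SubPos d n) {D : Set Ω}
    (hD : MeasurableSet[coinSigma keep (below (w ++ [a]))] D) :
    μ.real ({ω | keep (w, a) ω = true} ∩ D) = p * μ.real D := by
  rw [measureReal_inter_of_disjoint hmeas hindep (S := {(w, a)}) _ (measurableSet_coin rfl) hD,
    measureReal_def, hlaw, ENNReal.toReal_ofReal hp.1.le]
  rw [disjoint_singleton_left]
  exact fun h => by simpa using List.IsPrefix.length_le h

/-- The probability that a branching process survives is bounded below. -/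
lemma le_measureReal_alive (hpn : 1 < (n : ℝ) ^ d * p) (k : ℕ) (w : List (SubPos d n)) :
    1 - 1 / ((n : ℝ) ^ d * p) ≤ μ.real {ω | Alive (fun q => keep q ω) k w} := by
  set M : ℝ := (n : ℝ) ^ d * p with hM
  have hM0 : 0 < M := by linarith
  -- Chosen so that `1 + M * θ = M`. The induction needs `(1 - p * θ) ^ (n ^ d) ≤ 1 / M`, which
  -- follows from Bernoulli's `(1 + p * θ) ^ (n ^ d) ≥ 1 + M * θ` and `(1 - p * θ) * (1 + p * θ) ≤
  -- 1`.
  set θ : ℝ := 1 - 1 / M with hθ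
  have hθ0 : 0 ≤ θ := by
    rw [hθ, sub_nonneg, div_le_one hM0]; exact hpn.le
  have hθ1 : θ ≤ 1 := by
    rw [hθ]; linarith [show 0 ≤ 1 / M by positivity]
  induction k generalizing w with
  | zero => simpa [Alive] using hθ1
  | succ k ih =>
    set E : SubPos d n → Set Ω := fun a =>
      {ω | keep (w, a) ω = true} ∩ {ω | Alive (fun q => keep q ω) k (w ++ [a])} with hE
    have hEm : ∀ a, MeasurableSet[coinSigma keep (insert (w, a) (below (w ++ [a])))] (E a) :=
      fun a => measurableSet_child w a (measurableSet_alive k _)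
    have hEm' : ∀ a, MeasurableSet (E a) := fun a => coinSigma_le hmeas _ _ (hEm a)
    have hset : {ω | Alive (fun q => keep q ω) (k + 1) w} = (⋂ a ∈ Finset.univ, (E a)ᶜ)ᶜ := by
      ext ω; simp [Alive, hE]
    rw [hset, probReal_compl_eq_one_sub (Finset.measurableSet_biInter _ fun a _ => (hEm' a).compl),
      measureReal_biInter_of_disjoint hmeas hindep (disjoint_child_below w)
        (fun a => (hEm a).compl)]
    have hx1 : p * θ ≤ 1 := mul_le_one₀ hp.2.le hθ0 hθ1
    have hx0 : 0 ≤ p * θ := mul_nonneg hp.1.le hθ0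
    have h1 : ∏ a : SubPos d n, μ.real (E a)ᶜ ≤ ∏ _a : SubPos d n, (1 - p * θ) := by
      refine Finset.prod_le_prod (fun a _ => measureReal_nonneg) fun a _ => ?_
      rw [probReal_compl_eq_one_sub (hEm' a),
        measureReal_child hp hmeas hindep hlaw w a (measurableSet_alive k _)]
      linarith [mul_le_mul_of_nonneg_left (ih (w ++ [a])) hp.1.le]
    have h2 : ∏ _a : SubPos d n, (1 - p * θ) = (1 - p * θ) ^ (n ^ d) := by simp
    have h3 : (1 - p * θ) ^ (n ^ d) * M ≤ 1 := by
      calc (1 - p * θ) ^ (n ^ d) * M ≤ (1 - p * θ) ^ (n ^ d) * (1 + p * θ) ^ (n ^ d) := by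
            refine mul_le_mul_of_nonneg_left ?_ (pow_nonneg (by linarith) _)
            refine le_trans (le_of_eq ?_) (one_add_mul_le_pow (by linarith) (n ^ d))
            have : M * θ = M - 1 := by rw [hθ]; field_simp
            push_cast
            rw [← mul_assoc, ← hM, this]; ring
        _ = (1 - (p * θ) ^ 2) ^ (n ^ d) := by rw [← mul_pow]; ring
        _ ≤ 1 := pow_le_one₀ (by nlinarith) (by nlinarith)
    rw [← le_div_iff₀ hM0] at h3
    linarith

/-- Independence of the children turns a bound `γ` for `m` into `(p * γ) ^ (n ^ d)` for `m + 1`.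
Uniformity in `w` is the point. -/
lemma exists_pos_le_measureReal_rich (hpn : 1 < (n : ℝ) ^ d * p) (m : ℕ) :
    ∃ γ : ℝ, 0 < γ ∧ ∀ w : List (SubPos d n), γ ≤ μ.real {ω | Rich (fun q => keep q ω) m w} := by
  induction m with
  | zero =>
    refine ⟨1 - 1 / ((n : ℝ) ^ d * p), ?_, fun w => ?_⟩
    · rw [sub_pos, div_lt_one (by linarith)]; exact hpn
    · have hset : {ω | Rich (fun q => keep q ω) 0 w} =
          ⋂ k, {ω | Alive (fun q => keep q ω) k w} := by ext; simp [Rich]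
      rw [hset]
      have hlim := tendsto_measure_iInter_atTop (μ := μ)
        (s := fun k => {ω | Alive (fun q => keep q ω) k w})
        (fun k => (coinSigma_le hmeas _ _ (measurableSet_alive k w)).nullMeasurableSet)
        (antitone_nat_of_succ_le fun k ω (hω : Alive _ _ _) => hω.of_succ) ⟨0, measure_ne_top _ _⟩
      exact ge_of_tendsto' ((ENNReal.tendsto_toReal (measure_ne_top _ _)).comp hlim)
        fun k => le_measureReal_alive hp hmeas hindep hlaw hpn k w
  | succ m ih =>
    obtain ⟨γ, hγ, h⟩ := ih
    refine ⟨(p * γ) ^ (n ^ d), pow_pos (mul_pos hp.1 hγ) _, fun w => ?_⟩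
    have hset : {ω | Rich (fun q => keep q ω) (m + 1) w} = ⋂ a ∈ Finset.univ,
        ({ω | keep (w, a) ω = true} ∩ {ω | Rich (fun q => keep q ω) m (w ++ [a])}) := by
      ext ω; simp [Rich]
    rw [hset, measureReal_biInter_of_disjoint hmeas hindep (disjoint_child_below w)
      (fun a => measurableSet_child w a (measurableSet_rich m _))]
    calc (p * γ) ^ (n ^ d) = ∏ _a : SubPos d n, (p * γ) := by simp
      _ ≤ _ := by
        refine Finset.prod_le_prod (fun a _ => (mul_pos hp.1 hγ).le) fun a _ => ?_
        rw [measureReal_child hp hmeas hindep hlaw w a (measurableSet_rich m _)]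
        exact mul_le_mul_of_nonneg_left (h _) hp.1.le

lemma measure_percSet_nonempty_pos (hpn : 1 < (n : ℝ) ^ d * p) :
    0 < μ {ω | (percSet (fun q => keep q ω)).Nonempty} := by
  obtain ⟨γ, hγ, h⟩ := exists_pos_le_measureReal_rich hp hmeas hindep hlaw hpn 0
  have h1 : 0 < μ {ω | Rich (fun q => keep q ω) 0 []} :=
    (ENNReal.toReal_pos_iff.1 (hγ.trans_le (h []))).1
  refine h1.trans_le (measure_mono fun ω hω => ?_)
  exact (meshCube_inter_percSet_nonempty fun k =>
    (hω k).exists_survives survives_nil).mono inter_subset_right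

/-- On non-extinction, there are almost surely rich cubes of arbitrarily large generation. -/
lemma ae_exists_rich (hpn : 1 < (n : ℝ) ^ d * p) (m L : ℕ) :
    ∀ᵐ ω ∂μ, (percSet (fun q => keep q ω)).Nonempty →
      ∃ w : List (SubPos d n), L ≤ w.length ∧ Survives (fun q => keep q ω) w ∧
        Rich (fun q => keep q ω) m w := by
  obtain ⟨γ, hγ, hrich⟩ := exists_pos_le_measureReal_rich hp hmeas hindep hlaw hpn m
  -- The toss `(v, a)` decides a cube of level `v.length + 1`, so `ℱ k` knows exactly the tosses for
  -- levels at most `k` and is independent of those in `below w` when `w.length = k`.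
  let ℱ : Filtration ℕ mΩ :=
    { seq := fun k => coinSigma keep {q | q.1.length < k}
      mono' := fun i j hij => coinSigma_mono fun q (hq : q.1.length < i) => hq.trans_le hij
      le' := fun k => coinSigma_le hmeas _ }
  set A : Set Ω := {ω | ∃ w : List (SubPos d n), L ≤ w.length ∧
    Survives (fun q => keep q ω) w ∧ Rich (fun q => keep q ω) m w} with hA
  have hAm : MeasurableSet[⨆ k, ℱ k] A := by
    have hle : coinSigma keep univ ≤ ⨆ k, ℱ k := iSup₂_le fun q _ =>
      le_trans (le_biSup (fun q => MeasurableSpace.comap (keep q) inferInstance)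
        (show q ∈ {q' : List (SubPos d n) × SubPos d n | q'.1.length < q.1.length + 1} from
          Nat.lt_succ_self _)) (le_iSup (fun k => ℱ k) (q.1.length + 1))
    refine hle _ ?_
    simp only [hA, ofPred_exists, ofPred_and]
    exact .iUnion fun w => (MeasurableSet.const _).inter
      ((measurableSet_survives (subset_univ _)).inter
        (coinSigma_mono (subset_univ _) _ (measurableSet_rich m w)))
  have hAm' : MeasurableSet A := (iSup_le fun k => ℱ.le k : ⨆ k, ℱ k ≤ mΩ) _ hAm
  set f : Ω → ℝ := A.indicator fun _ => 1 with hf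
  have hfint : Integrable f μ := (integrable_const 1).indicator hAm'
  have hlevy := hfint.tendsto_ae_condExp (ℱ := ℱ)
    ((@stronglyMeasurable_const _ _ (⨆ k, ℱ k) _ (1 : ℝ)).indicator hAm)
  -- Where `w` survives, richness of `w` already gives `A`, and its conditional probability given `ℱ
  -- w.length` is its plain probability, at least `γ`. There are countably many words, so one null
  -- set suffices.
  have hlow : ∀ᵐ ω ∂μ, ∀ w : List (SubPos d n), L ≤ w.length →
      Survives (fun q => keep q ω) w → γ ≤ (μ[f | ℱ w.length]) ω := by
    rw [ae_all_iff]
    intro w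
    by_cases hw : L ≤ w.length
    swap
    · exact .of_forall fun ω h => absurd h hw
    set S : Set Ω := {ω | Survives (fun q => keep q ω) w}
    set G : Set Ω := {ω | Rich (fun q => keep q ω) m w} with hG
    have hSm : MeasurableSet[ℱ w.length] S := measurableSet_survives subset_rfl
    have hGm : MeasurableSet[coinSigma keep (below w)] G := measurableSet_rich m w
    have hGm' : MeasurableSet G := coinSigma_le hmeas _ _ hGm
    have hGint : Integrable (G.indicator fun _ => (1 : ℝ)) μ :=
      (integrable_const 1).indicator hGm'
    have hle : S.indicator (G.indicator fun _ => (1 : ℝ)) ≤ᵐ[μ] f := .of_forall fun ω => by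
      rw [indicator_indicator, hf]
      exact indicator_le_indicator_of_subset (show S ∩ G ⊆ A from fun ω hω => ⟨w, hw, hω.1, hω.2⟩)
        (fun _ => zero_le_one) ω
    have hind : Indep (coinSigma keep (below w)) (ℱ w.length) μ := by
      refine indep_coinSigma hmeas hindep (disjoint_left.2 fun q hq hq' => ?_)
      exact absurd (List.IsPrefix.length_le hq) (not_le.2 hq')
    have h1 := condExp_mono (m := ℱ w.length) (hGint.indicator (ℱ.le _ _ hSm)) hfint hle
    have h2 := condExp_indicator hGint hSm
    have h3 := condExp_indep_eq (μ := μ) (coinSigma_le hmeas (below w)) (ℱ.le w.length)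
      ((@stronglyMeasurable_const _ _ (coinSigma keep (below w)) _ (1 : ℝ)).indicator hGm) hind
    filter_upwards [h1, h2, h3] with ω h1 h2 h3 _ hs
    rw [h2, indicator_of_mem (show ω ∈ S from hs), h3, integral_indicator_const _ hGm'] at h1
    exact (hrich w).trans (by simpa using h1)
  filter_upwards [hlevy, hlow] with ω hlim hω hne
  by_contra hnot
  have h0 : f ω = 0 := indicator_of_notMem (show ω ∉ A from hnot) _
  rw [h0] at hlim
  -- Non-extinction supplies a surviving word of every length `k ≥ L`, keeping the martingale at
  -- least `γ`, against its limit 0.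
  refine absurd (ge_of_tendsto hlim ?_) (not_le.2 hγ)
  filter_upwards [Filter.eventually_ge_atTop L] with k hk
  obtain ⟨w, rfl, hs⟩ := percSet_nonempty_iff.1 hne k
  exact hω w hk hs

end Branching

end Probability

theorem theorem5p1 {Ω : Type*} [MeasurableSpace Ω] (μ : Measure Ω) [IsProbabilityMeasure μ]
    (d n : ℕ) (hn : 2 ≤ n) (p : ℝ) (hp : p ∈ Ioo (0 : ℝ) 1) (hpn : 1 / (n : ℝ) ^ d < p)
    (keep : List (SubPos d n) × SubPos d n → Ω → Bool)
    (hmeas : ∀ q, Measurable (keep q))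
    (hindep : iIndepFun keep μ)
    (hlaw : ∀ q, μ {ω | keep q ω = true} = ENNReal.ofReal p) :
    0 < μ {ω | (percSet (fun q => keep q ω)).Nonempty} ∧
    ∀ᵐ ω ∂(μ[|{ω | (percSet (fun q => keep q ω)).Nonempty}]),
      assouadDim (percSet (fun q => keep q ω)) = d ∧
      ∀ k : ℕ, k ≤ d → ∀ V : Submodule ℝ (EuclideanSpace ℝ (Fin d)), Module.finrank ℝ V = k →
        assouadDim (V.orthogonalProjectionOnto '' percSet (fun q => keep q ω)) = k := by
  have hpn' : 1 < (n : ℝ) ^ d * p := by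
    rw [div_lt_iff₀ (by positivity)] at hpn
    linarith
  -- For `d = 0` the hypothesis would read `1 < p`.
  have hd : 0 < d := by
    rcases Nat.eq_zero_or_pos d with rfl | hd
    · rw [pow_zero, one_mul] at hpn'
      exact absurd hp.2 (not_lt.2 hpn'.le)
    · exact hd
  refine ⟨measure_percSet_nonempty_pos hp hmeas hindep hlaw hpn', ?_⟩
  have hae : ∀ᵐ ω ∂μ, ∀ m L : ℕ, (percSet (fun q => keep q ω)).Nonempty →
      ∃ w : List (SubPos d n), L ≤ w.length ∧ Survives (fun q => keep q ω) w ∧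
        Rich (fun q => keep q ω) m w := by
    simp only [ae_all_iff]
    exact fun m L => ae_exists_rich hp hmeas hindep hlaw hpn' m L
  filter_upwards [cond_absolutelyContinuous.ae_le hae,
    ae_cond_mem (measurableSet_percSet_nonempty hmeas)] with ω hω hne
  have hrich := fun m L => hω m L hne
  constructor
  · have := assouadDim_image_percSet hn hd hrich LinearMap.id (fun _ => le_rfl) id
      (fun _ => le_rfl) (fun _ => rfl)
    simpa using this
  · rintro k - V rfl
    exact assouadDim_image_percSet hn hd hrich V.orthogonalProjectionOnto.toLinearMap
      V.norm_orthogonalProjectionOnto_apply_le Subtype.val (fun _ => le_rfl)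
      V.orthogonalProjectionOnto_mem_subspace_eq_self
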